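/- Let $\mathsf H$ be a separable complex Hilbert space and let $\hbar,c>0$. Let $\widehat M$ and $\widehat H$ be (possibly unbounded) self-adjoint operators on $\mathsf H$, with $\widehat M$ having pure point, strictly positive spectrum, $\sigma(\widehat M)=\sigma_p(\widehat M)\subset(0,+\infty)$, such that the strongly continuous one-parameter unitary groups $s\mapsto e^{-is\widehat M}$ and $s\mapsto e^{-is\widehat H}$ commute, and let the time evolution be $U_t=e^{-i\frac{tc^2}{\hbar}\widehat M}\,e^{-i\frac{t}{\hbar}\widehat H}$. Let $P_M$ be the orthogonal projector onto the eigenspace $\mathsf H_M$ of $\widehat M$ with eigenvalue $M$. Let $\Psi=\sum_{M\in S}\Psi_M$ with $S\subset\sigma_p(\widehat M)$ finite, $\Psi_M\in\mathsf H_M\cap D(\widehat H)$ and $\|\Psi\|=1$. Let $N_\Psi$ be the number of elements of $S$, let $\delta M_\Psi>0$ be the smallest difference of two different elements of $S$ (with $\delta M_\Psi=+\infty$, $1/\delta M_\Psi=0$, if $N_\Psi=1$), and let $$E_\Psi=\max_{M\in S}\sqrt{\langle\widehat H\rangle_{\Psi_M}^2+(\Delta\widehat H_{\Psi_M})^2},\qquad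 \langle\widehat H\rangle_x=\int\lambda\,d\langle x|P^{(\widehat H)}(\lambda)x\rangle,\quad \Delta\widehat H_x=\Big(\int(\lambda^2-\langle\widehat H\rangle_x^2)\,d\langle x|P^{(\widehat H)}(\lambda)x\rangle\Big)^{1/2},$$ where $P^{(\widehat H)}$ is the spectral measure of $\widehat H$. Let $\rho_\Psi=\sum_{M\in S}p_M\,\Phi_M\langle\Phi_M|\,\cdot\,\rangle$ with $p_M=\|\Psi_M\|^2$ and $\Phi_M=\Psi_M/\|\Psi_M\|$ (terms with $\Psi_M=0$ being omitted). For every bounded operator $A$ on $\mathsf H$ the series $A_B=\sum_{M\in\sigma(\widehat M)}P_MAP_M$ converges in the strong operator topology to a bounded operator, $\rho_\Psi A_B$ is of trace class with $$\operatorname{tr}(\rho_\Psi A_B)=\sum_{M\in S}\langle\Psi_M|A\Psi_M\rangle,$$ and for every $T>0$ $$\left|\frac1T\int_0^T\langle\Psi|U_t^*AU_t\Psi\rangle\,dt-\sum_{M\in S}\langle\Psi_M|A\Psi_M\rangle\right|\le\frac{2\hbar N_\Psi^2\|A\|}{\delta M_\Psi\,c^2\,T}+\frac{2TN_\Psi^2\|A\|E_\Psi}{\hbar}.$$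 Consequently, in the regime $\frac{2\hbar N_\Psi^2\|A\|}{\delta M_\Psi c^2}\ll T\ll\frac{\hbar}{2N_\Psi^2\|A\|E_\Psi}$ the time average approaches $\operatorname{tr}(\rho_\Psi A_B)$: along every filtered family of such data (all of $\mathsf H,\hbar,c,\widehat M,\widehat H,\Psi,A,T$ may vary) for which both $\frac{2\hbar N_\Psi^2\|A\|}{\delta M_\Psi c^2T}\to0$ and $\frac{2TN_\Psi^2\|A\|E_\Psi}{\hbar}\to0$, the difference $\frac1T\int_0^T\langle\Psi|U_t^*AU_t\Psi\rangle\,dt-\operatorname{tr}(\rho_\Psi A_B)$ tends to $0$. -/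

import Mathlib

open scoped InnerProductSpace
open Filter Topology MeasureTheory

noncomputable section

namespace MassSuperselection

universe u

variable {H : Type u} [NormedAddCommGroup H] [InnerProductSpace ℂ H] [CompleteSpace H]

/-! ### Spectrum and eigenspaces of an unbounded operator -/

/-- The resolvent set of an operator `T` with domain `T.domain`: the `z` for which `T - z` is a
bijection of the domain onto the whole space with a bounded (everywhere defined) inverse `R`. -/
def resolventSet (T : H →ₗ.[ℂ] H) : Set ℂ :=
  {z | ∃ R : H →L[ℂ] H,
    (∀ y : H, ∃ h : R y ∈ T.domain, T ⟨R y, h⟩ - z • R y = y) ∧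
    (∀ x : T.domain, R (T x - z • (x : H)) = x)}

/-- The spectrum `σ(T)`. -/
def spectrum (T : H →ₗ.[ℂ] H) : Set ℂ := (resolventSet T)ᶜ

/-- The eigenspace `{x ∈ D(T) | T x = z x}`. -/
def eigenspace (T : H →ₗ.[ℂ] H) (z : ℂ) : Submodule ℂ H where
  carrier := {x | ∃ h : x ∈ T.domain, T ⟨x, h⟩ = z • x}
  zero_mem' := ⟨T.domain.zero_mem, by
    have h : T (0 : T.domain) = 0 := T.map_zero
    rw [smul_zero]; exact h⟩
  add_mem' := by
    rintro x y ⟨hx, ex⟩ ⟨hy, ey⟩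
    refine ⟨T.domain.add_mem hx hy, ?_⟩
    have h := T.map_add ⟨x, hx⟩ ⟨y, hy⟩
    rw [smul_add, ← ex, ← ey]
    exact h
  smul_mem' := by
    rintro a x ⟨hx, ex⟩
    refine ⟨T.domain.smul_mem a hx, ?_⟩
    have h := T.map_smul a ⟨x, hx⟩
    rw [smul_comm, ← ex]
    exact h

/-- The point spectrum `σ_p(T)`: the set of eigenvalues. -/
def pointSpectrum (T : H →ₗ.[ℂ] H) : Set ℂ := {z | eigenspace T z ≠ ⊥}

/-- The orthogonal projector onto the eigenspace of `T` with eigenvalue `z`. (For a closed, in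
particular for a self-adjoint `T` the eigenspace is closed; taking the closure only makes the
definition meaningful for every `T`.) -/
def eigenprojection (T : H →ₗ.[ℂ] H) (z : ℂ) : H →L[ℂ] H :=
  (eigenspace T z).topologicalClosure.starProjection

/-! ### Strongly continuous one-parameter unitary groups -/

/-- A strongly continuous one-parameter group of unitary operators. -/
structure UnitaryGroup (H : Type u) [NormedAddCommGroup H] [InnerProductSpace ℂ H]
    [CompleteSpace H] where
  /-- the operator at the parameter `s` -/
  op : ℝ → H →L[ℂ] H
  mem_unitary : ∀ s, op s ∈ unitary (H →L[ℂ] H)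
  map_zero : op 0 = 1
  map_add : ∀ s t, op (s + t) = op s * op t
  continuous : ∀ x, Continuous fun s => op s x

namespace UnitaryGroup

/-- The self-adjoint generator `O` of the group, `V_s = e^{-isO}`: its domain consists of the `x`
for which `s ↦ V_s x` is differentiable at `0`, and `O x = i (d/ds) V_s x` at `s = 0`. -/
def generator (V : UnitaryGroup H) : H →ₗ.[ℂ] H where
  domain :=
    { carrier := {x | DifferentiableAt ℝ (fun s => V.op s x) 0}
      zero_mem' := by simp
      add_mem' := by
        intro x y hx hy
        have h := DifferentiableAt.fun_add (𝕜 := ℝ) hx hy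
        simpa using h
      smul_mem' := by
        intro a x hx
        have h := DifferentiableAt.fun_const_smul (𝕜 := ℝ) hx a
        simpa using h }
  toFun :=
    { toFun := fun x => Complex.I • deriv (fun s => V.op s (x : H)) 0
      map_add' := by
        intro x y
        have h := deriv_fun_add (𝕜 := ℝ) x.2 y.2
        simp only [Submodule.coe_add, _root_.map_add]
        rw [h, smul_add]
      map_smul' := by
        intro a x
        have h := deriv_fun_const_smul (𝕜 := ℝ) a x.2
        simp only [Submodule.coe_smul, _root_.map_smul, RingHom.id_apply]
        rw [h, smul_comm] }

/-- The spectral measure `B ↦ ⟨x | P(B) x⟩` of the generator `O` of `V` in the vector `x`, where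
`P` is the projection-valued measure of `O`: it is the unique finite Borel measure `μ` on the real
line with `⟨x | e^{-isO} x⟩ = ∫ e^{-isλ} dμ(λ)` for all `s`. -/
def spectralMeasure (V : UnitaryGroup H) (x : H) : Measure ℝ :=
  open Classical in
  if h : ∃ μ : Measure ℝ, IsFiniteMeasure μ ∧
      ∀ s : ℝ, ⟪x, V.op s x⟫_ℂ = ∫ r, Complex.exp (-(Complex.I * s * r)) ∂μ
  then h.choose else 0

/-- The mean value `⟨O⟩_x = ∫ λ d⟨x | P(λ) x⟩` of the generator `O` of `V`. -/
def mean (V : UnitaryGroup H) (x : H) : ℝ := ∫ r, r ∂(V.spectralMeasure x)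

/-- The standard deviation `ΔO_x = √(∫ (λ² - ⟨O⟩_x²) d⟨x | P(λ) x⟩)` of the generator `O`. -/
def deviation (V : UnitaryGroup H) (x : H) : ℝ :=
  √(∫ r, (r ^ 2 - V.mean x ^ 2) ∂(V.spectralMeasure x))

end UnitaryGroup

/-! ### Traces and block-diagonal parts -/

/-- The bounded operator `B` is of trace class with `tr B = t`: the series `∑ ⟨e_j | B e_j⟩`
converges unconditionally to `t` for every Hilbert basis `(e_j)`. -/
def HasTrace (B : H →L[ℂ] H) (t : ℂ) : Prop :=
  ∀ (J : Type u) (e : HilbertBasis J ℂ H), HasSum (fun j => ⟪e j, B (e j)⟫_ℂ) t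

/-- `B = ∑_{z ∈ σ(T)} P_z A P_z` in the strong operator topology, with `P_z` the
eigenprojections of `T`. -/
def IsBlockDiagonalPart (T : H →ₗ.[ℂ] H) (A B : H →L[ℂ] H) : Prop :=
  ∀ x : H, HasSum
    (fun z : spectrum T => eigenprojection T z (A (eigenprojection T z x))) (B x)

/-! ### Systems with a mass operator -/

/-- A quantum system with a mass operator: positive constants `ħ` and `c`, self-adjoint operators
`M` (with `σ(M) = σ_p(M) ⊆ (0, ∞)`) and `H`, and the strongly continuous unitary groups
`s ↦ e^{-isM}` and `s ↦ e^{-isH}` which they generate and which commute. -/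
structure MassSystem (H : Type u) [NormedAddCommGroup H] [InnerProductSpace ℂ H]
    [CompleteSpace H] where
  /-- the reduced Planck constant -/
  hbar : ℝ
  hbar_pos : 0 < hbar
  /-- the speed of light -/
  c : ℝ
  c_pos : 0 < c
  /-- the mass operator -/
  mass : H →ₗ.[ℂ] H
  mass_selfAdjoint : IsSelfAdjoint mass
  spectrum_mass : spectrum mass = pointSpectrum mass
  spectrum_mass_pos : ∀ z ∈ spectrum mass, ∃ m : ℝ, 0 < m ∧ z = m
  /-- the Hamiltonian without the mass term -/
  ham : H →ₗ.[ℂ] H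
  ham_selfAdjoint : IsSelfAdjoint ham
  /-- the group `s ↦ e^{-is mass}` -/
  expMass : UnitaryGroup H
  expMass_generator : expMass.generator = mass
  /-- the group `s ↦ e^{-is ham}` -/
  expHam : UnitaryGroup H
  expHam_generator : expHam.generator = ham
  commute : ∀ s t, Commute (expMass.op s) (expHam.op t)

/-- The time evolution `U_t = e^{-i(tc²/ħ)M} e^{-i(t/ħ)H}`. -/
def MassSystem.evolution (Q : MassSystem H) (t : ℝ) : H →L[ℂ] H :=
  Q.expMass.op (t * Q.c ^ 2 / Q.hbar) * Q.expHam.op (t / Q.hbar)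

/-- A unit vector that is a finite superposition `∑_{M ∈ S} Ψ_M` of vectors `Ψ_M ∈ D(H)` of the
mass eigenspaces with eigenvalues `M ∈ S ⊆ σ_p`. -/
structure Superposition (Q : MassSystem H) where
  /-- the finite set of masses -/
  S : Finset ℝ
  mem_pointSpectrum : ∀ M ∈ S, (M : ℂ) ∈ pointSpectrum Q.mass
  /-- the components `Ψ_M` -/
  comp : ℝ → H
  comp_mem_eigenspace : ∀ M ∈ S, comp M ∈ eigenspace Q.mass (M : ℂ)
  comp_mem_domain : ∀ M ∈ S, comp M ∈ Q.ham.domain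
  norm_sum : ‖∑ M ∈ S, comp M‖ = 1

namespace Superposition

variable {Q : MassSystem H} (Ψ : Superposition Q)

/-- The state vector `Ψ = ∑_{M ∈ S} Ψ_M`. -/
def vec : H := ∑ M ∈ Ψ.S, Ψ.comp M

/-- The number `N_Ψ` of elements of `S`. -/
def N : ℕ := Ψ.S.card

/-- The smallest difference `δM_Ψ` of two different elements of `S`. If `S` has one element only,
then there is no such pair and the value is `0`, so that a quotient by it is `0` as well, in
agreement with the reading `δM_Ψ = +∞`. -/
def δM : ℝ := sInf {d | ∃ M ∈ Ψ.S, ∃ M' ∈ Ψ.S, M ≠ M' ∧ d = |M - M'|}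

/-- `E_Ψ = max_{M ∈ S} √(⟨H⟩² + (ΔH)²)`, mean and deviation being taken in `Ψ_M`. -/
def E : ℝ :=
  sSup ((fun M => √(Q.expHam.mean (Ψ.comp M) ^ 2 + Q.expHam.deviation (Ψ.comp M) ^ 2)) '' Ψ.S)

/-- The mixed state `ρ_Ψ = ∑_{M ∈ S} p_M Φ_M ⟨Φ_M | · ⟩` with `Φ_M = Ψ_M / ‖Ψ_M‖` and
`p_M = ‖Ψ_M‖²` (components that vanish do not contribute). -/
def mixture : H →L[ℂ] H :=
  ∑ M ∈ Ψ.S, ((‖Ψ.comp M‖ ^ 2 : ℝ) : ℂ) •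
    InnerProductSpace.rankOne ℂ (((‖Ψ.comp M‖⁻¹ : ℝ) : ℂ) • Ψ.comp M)
      (((‖Ψ.comp M‖⁻¹ : ℝ) : ℂ) • Ψ.comp M)

/-- The effective expectation value `(1/T) ∫_0^T ⟨Ψ | U_t^* A U_t Ψ⟩ dt`. -/
def timeAverage (A : H →L[ℂ] H) (T : ℝ) : ℂ :=
  (1 / T : ℂ) * ∫ t in (0 : ℝ)..T,
    ⟪Ψ.vec, ContinuousLinearMap.adjoint (Q.evolution t) (A (Q.evolution t Ψ.vec))⟫_ℂ

/-- The diagonal value `∑_{M ∈ S} ⟨Ψ_M | A Ψ_M⟩`. -/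
def diagonalValue (A : H →L[ℂ] H) : ℂ := ∑ M ∈ Ψ.S, ⟪Ψ.comp M, A (Ψ.comp M)⟫_ℂ

/-- The quotient `2ħN²‖A‖ / (δM c² T)` of the lower time scale by `T`. -/
def lowerRatio (A : H →L[ℂ] H) (T : ℝ) : ℝ :=
  2 * Q.hbar * (Ψ.N : ℝ) ^ 2 * ‖A‖ / (Ψ.δM * Q.c ^ 2 * T)

/-- The quotient `2TN²‖A‖E / ħ` of `T` by the upper time scale `ħ / (2N²‖A‖E)`. -/
def upperRatio (A : H →L[ℂ] H) (T : ℝ) : ℝ :=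
  2 * T * (Ψ.N : ℝ) ^ 2 * ‖A‖ * Ψ.E / Q.hbar

end Superposition

end MassSuperselection

end

/-! On the component `Ψ_M` the mass group is the phase `e^{-iMtc²/ħ}`, so the expectation at time
`t` is a double sum over pairs `(M, M')` of `e^{i(M-M')tc²/ħ}` times a matrix element of `A` between
components evolved by `H` alone. Two errors separate its time average from the diagonal sum.
Freezing the `H`-evolution costs at most `2‖A‖(T/ħ)E` per pair; the frozen off-diagonal terms are
pure oscillations, whose averages are at most `2ħ‖A‖/(δM c² T)`. Summing over `N²` pairs gives the
two ratios.

The freezing estimate (`norm_op_sub_le`) needs `‖e^{-isH}x - x‖² ≤ s² ∫ λ² dμ_x`, hence a spectral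
measure `μ_x`. It is built by Bochner's theorem (`exists_spectralMeasure`) directly from the unitary
group; its second moment is finite on the domain of the generator by Fatou's lemma.

The block-diagonal part converges by Bessel's inequality for the mutually orthogonal eigenspaces,
and its trace against the mixture reduces to Parseval's identity for rank-one operators. -/

noncomputable section

namespace MassSuperselection

universe u

/-! ### Nonnegative Fourier transforms and characteristic functions -/

section Bochner

open scoped FourierTransform

/-- A continuous integrable function with nonnegative Fourier transform has an integrable Fourier
transform. -/
theorem integrable_fourier_of_nonneg {f : ℝ → ℂ} {g : ℝ → ℝ} (hc : Continuous f)
    (hf : Integrable f) (hg : ∀ w, 𝓕 f w = (g w : ℂ)) (hg0 : ∀ w, 0 ≤ g w) :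
    Integrable g := by
  have hFc : Continuous (𝓕 f) :=
    VectorFourier.fourierIntegral_continuous Real.continuous_fourierChar
      (innerSL ℝ (E := ℝ)).continuous₂ hf
  have hgc : Continuous g := by
    have : g = fun w => (𝓕 f w).re := by ext w; simp [hg]
    rw [this]
    exact Complex.continuous_re.comp hFc
  have hgb : ∀ w, ‖g w‖ ≤ ∫ v, ‖f v‖ := fun w => by
    have h1 : ‖𝓕 f w‖ ≤ ∫ v, ‖f v‖ := VectorFourier.norm_fourierIntegral_le_integral_norm _ _ _ _ _
    rw [hg] at h1
    simpa using h1
  let G : ℕ → ℝ → ℝ := fun n w => Real.exp (-((n : ℝ) + 1)⁻¹ * w ^ 2) * g w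
  have hGint : ∀ n, Integrable (G n) := fun n =>
    (integrable_exp_neg_mul_sq (b := ((n : ℝ) + 1)⁻¹) (by positivity)).mul_bdd
      (c := ∫ v, ‖f v‖) hgc.aestronglyMeasurable (ae_of_all _ hgb)
  have hcast : Tendsto (fun n : ℕ => (n : ℝ) + 1) atTop atTop :=
    tendsto_atTop_add_const_right _ _ tendsto_natCast_atTop_atTop
  -- The multiplication formula moves the Fourier transform from `f` to the Gaussian, whose
  -- transform is an approximate identity at `0`.
  have key : Tendsto (fun n : ℕ => ((∫ w, G n w : ℝ) : ℂ)) atTop (𝓝 (f 0)) := by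
    refine ((Real.tendsto_integral_gaussian_smul' hf
      (v := 0) hc.continuousAt).comp hcast).congr fun n => ?_
    have hn : (0 : ℝ) < (n : ℝ) + 1 := by positivity
    have J : Integrable (fun w : ℝ => Complex.exp (-((((n : ℝ) + 1 : ℝ) : ℂ))⁻¹ * ‖w‖ ^ 2
        + 2 * Real.pi * Complex.I * ⟪(0 : ℝ), w⟫_ℝ)) :=
      GaussianFourier.integrable_cexp_neg_mul_sq_norm_add
        (by rw [← Complex.ofReal_inv, Complex.ofReal_re]; positivity) _ _
    have h := VectorFourier.integral_fourierIntegral_smul_eq_flip (L := innerₗ ℝ)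
      Real.continuous_fourierChar continuous_inner J hf
    have h2 : ∀ w : ℝ, VectorFourier.fourierIntegral 𝐞 volume (innerₗ ℝ).flip f w = (g w : ℂ) := by
      intro w
      rw [← hg w, flip_innerₗ]
      rfl
    simp only [h2] at h
    rw [← integral_complex_ofReal]
    convert! h using 1
    · simp only [Function.comp]
      congr 1
      ext w
      congr 1
      have := fourier_gaussian_innerProductSpace' (b := (((n : ℝ) + 1 : ℝ) : ℂ)⁻¹)
        (by rw [← Complex.ofReal_inv, Complex.ofReal_re]; positivity) (0 : ℝ) w
      refine Eq.trans ?_ this.symm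
      congr 1
      · simp
      · simp
        ring_nf
    · simp [G, ← Complex.ofReal_pow]
  -- Fatou: `G n → g` pointwise, and by nonnegativity the `L¹` norms of `G n` are the integrals in
  -- `key`, which converge.
  refine integrable_of_tendsto (G := G) (ae_of_all _ fun w => ?_)
    (fun n => (hGint n).aestronglyMeasurable) ?_
  · have : Tendsto (fun n : ℕ => Real.exp (-((n : ℝ) + 1)⁻¹ * w ^ 2) * g w) atTop
        (𝓝 (Real.exp (-0 * w ^ 2) * g w)) :=
      ((Real.continuous_exp.tendsto _).comp
        (((tendsto_inv_atTop_zero.comp hcast).neg).mul_const _)).mul_const _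
    simpa [G] using this
  · have h1 : ∀ n, ∫⁻ w, ‖G n w‖ₑ = ENNReal.ofReal (∫ w, G n w) := fun n => by
      rw [ofReal_integral_eq_lintegral_ofReal (hGint n)
        (ae_of_all _ fun w => mul_nonneg (Real.exp_pos _).le (hg0 w))]
      exact lintegral_congr fun w =>
        Real.enorm_of_nonneg (mul_nonneg (Real.exp_pos _).le (hg0 w))
    simp only [h1]
    have h2 := ENNReal.tendsto_ofReal ((Complex.continuous_re.tendsto _).comp key)
    simp only [Function.comp_def, Complex.ofReal_re] at h2
    rw [h2.liminf_eq]
    exact ENNReal.ofReal_ne_top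

/-- A continuous integrable function with nonnegative Fourier transform and value `1` at `0` is
the characteristic function of a probability measure. -/
theorem exists_charFun_eq_of_fourier_nonneg {f : ℝ → ℂ} {g : ℝ → ℝ} (hc : Continuous f)
    (hf : Integrable f) (h1 : f 0 = 1) (hg : ∀ w, 𝓕 f w = (g w : ℂ)) (hg0 : ∀ w, 0 ≤ g w) :
    ∃ ν : Measure ℝ, IsProbabilityMeasure ν ∧ ∀ t, charFun ν t = f t := by
  have hgi := integrable_fourier_of_nonneg hc hf hg hg0
  have hgm : AEMeasurable (fun w => (g w).toNNReal) := hgi.aemeasurable.real_toNNReal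
  have hF : 𝓕 f = fun w => (g w : ℂ) := funext hg
  have hinv : 𝓕⁻ (𝓕 f) = f := hc.fourierInv_fourier_eq hf (by rw [hF]; exact hgi.ofReal)
  -- Fourier inversion exhibits `f` as the transform of the density `g`; the dilation by `2π`
  -- absorbs the factor that `charFun` lacks.
  let ν : Measure ℝ := (volume.withDensity fun w => ((g w).toNNReal : ENNReal)).map
    (fun w => 2 * Real.pi * w)
  have hν : ∀ t, charFun ν t = f t := by
    intro t
    rw [charFun_apply_real, integral_map (by fun_prop) (by fun_prop),
      integral_withDensity_eq_integral_smul₀ hgm]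
    conv_rhs => rw [← hinv, hF, Real.fourierInv_eq]
    congr 1
    ext w
    rw [NNReal.smul_def, Real.coe_toNNReal _ (hg0 w), Circle.smul_def, Real.fourierChar_apply,
      Complex.real_smul, smul_eq_mul, mul_comm]
    congr 2
    simp
    ring
  have : IsFiniteMeasure (volume.withDensity fun w => ((g w).toNNReal : ENNReal)) :=
    isFiniteMeasure_withDensity_ofReal hgi.2
  have : IsFiniteMeasure ν := by infer_instance
  refine ⟨ν, ?_, hν⟩
  have h0 := hν 0
  rw [charFun_zero, h1] at h0
  exact isProbabilityMeasure_iff_real.2 (by exact_mod_cast h0)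

/-- A pointwise limit of characteristic functions of probability measures that is continuous at `0`
is a characteristic function. -/
theorem exists_charFun_eq_of_tendsto {μ : ℕ → Measure ℝ} [∀ n, IsProbabilityMeasure (μ n)]
    {f : ℝ → ℂ} (hf : ContinuousAt f 0)
    (h : ∀ t, Tendsto (fun n => charFun (μ n) t) atTop (𝓝 (f t))) :
    ∃ ν : Measure ℝ, IsProbabilityMeasure ν ∧ ∀ t, charFun ν t = f t := by
  have htight := isTightMeasureSet_of_tendsto_charFun hf h
  let m : ℕ → ProbabilityMeasure ℝ := fun n => ⟨μ n, inferInstance⟩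
  have hcomp : IsCompact (closure (Set.range m)) := by
    apply isCompact_closure_of_isTightMeasureSet
    convert! htight
    ext ρ
    exact ⟨fun ⟨_, ⟨n, hn⟩, h⟩ => ⟨n, by rw [← h, ← hn]; rfl⟩, fun ⟨n, hn⟩ => ⟨m n, ⟨n, rfl⟩, hn⟩⟩
  -- Prokhorov gives compactness; an ultrafilter finer than `atTop` then replaces the choice of a
  -- convergent subsequence.
  let U : Ultrafilter ℕ := Ultrafilter.of atTop
  have hU : (U : Filter ℕ) ≤ atTop := Ultrafilter.of_le atTop
  obtain ⟨ν, -, hν⟩ := hcomp.ultrafilter_le_nhds (U.map m)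
    (.trans (by simp) (monotone_principal subset_closure))
  refine ⟨ν, inferInstance, fun t => ?_⟩
  have h2 : Tendsto m U (𝓝 ν) := hν
  rw [ProbabilityMeasure.tendsto_iff_forall_integral_rclike_tendsto ℂ] at h2
  have h3 := h2 (BoundedContinuousFunction.innerProbChar t)
  rw [charFun_eq_integral_innerProbChar]
  refine tendsto_nhds_unique h3 ?_
  refine ((h t).mono_left hU).congr fun n => ?_
  rw [charFun_eq_integral_innerProbChar]
  rfl

end Bochner

/-! ### Spectral measures and generators of unitary groups -/

namespace UnitaryGroup

variable {H : Type u} [NormedAddCommGroup H] [InnerProductSpace ℂ H] [CompleteSpace H]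

theorem inner_op_op (V : UnitaryGroup H) (s : ℝ) (x y : H) :
    ⟪V.op s x, V.op s y⟫_ℂ = ⟪x, y⟫_ℂ := by
  have h := (Unitary.mem_iff.1 (V.mem_unitary s)).1
  rw [← ContinuousLinearMap.adjoint_inner_right, ← ContinuousLinearMap.star_eq_adjoint,
    ← mul_apply_eq_comp, h, one_apply_eq_self]

theorem norm_op (V : UnitaryGroup H) (s : ℝ) (x : H) : ‖V.op s x‖ = ‖x‖ := by
  rw [← sq_eq_sq₀ (norm_nonneg _) (norm_nonneg _), ← inner_self_eq_norm_sq (𝕜 := ℂ),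
    ← inner_self_eq_norm_sq (𝕜 := ℂ), V.inner_op_op]

theorem inner_op_op_eq_sub (V : UnitaryGroup H) (s t : ℝ) (x y : H) :
    ⟪V.op s x, V.op t y⟫_ℂ = ⟪x, V.op (t - s) y⟫_ℂ := by
  conv_lhs => rw [show t = s + (t - s) by ring, V.map_add, mul_apply_eq_comp,
    V.inner_op_op]

open scoped FourierTransform

/-- The Fourier transform of a Gaussian times a matrix coefficient of a unitary group is
nonnegative. -/
theorem fourier_gaussian_mul_inner_nonneg (V : UnitaryGroup H) (x : H) {b : ℝ} (hb : 0 < b)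
    (w : ℝ) : ∃ r : ℝ, 0 ≤ r ∧
      𝓕 (fun t : ℝ => (Real.exp (-b * t ^ 2) : ℂ) * ⟪x, V.op (-t) x⟫_ℂ) w = r := by
  let e : ℝ → ℂ := fun a => Complex.exp (↑(-2 * Real.pi * a * w) * Complex.I)
  have he : Continuous e := by fun_prop
  have hen : ∀ a, ‖e a‖ = 1 := fun a => Complex.norm_exp_ofReal_mul_I _
  have hVc : Continuous fun a : ℝ => V.op (-a) x := (V.continuous x).comp continuous_neg
  let F : ℝ → ℂ := fun t => e t * ((Real.exp (-b * t ^ 2) : ℂ) * ⟪x, V.op (-t) x⟫_ℂ)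
  have hFc : Continuous F := by
    have : Continuous fun t : ℝ => ⟪x, V.op (-t) x⟫_ℂ := continuous_const.inner hVc
    fun_prop
  have hFi : Integrable F := by
    refine ((integrable_exp_neg_mul_sq hb).mul_const (‖x‖ * ‖x‖)).mono' hFc.aestronglyMeasurable
      (ae_of_all _ fun t => ?_)
    simp only [F, norm_mul, hen, one_mul, Complex.norm_real, Real.norm_eq_abs, Real.abs_exp]
    gcongr
    exact (norm_inner_le_norm _ _).trans_eq (by rw [V.norm_op])
  have h4b : 0 < 4 * b := by positivity
  -- The rate `2b` is chosen because `2ba² + 2b(t+a)² = 4b(a+t/2)² + bt²`: integrating `⟪G a, G (t +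
  -- a)⟫` over `a` leaves a constant times `F t`, so `∫ F` is a positive multiple of `‖∫ G‖²`.
  let G : ℝ → H := fun a => (Real.exp (-(2 * b) * a ^ 2) : ℂ) • e a • V.op (-a) x
  have hGi : Integrable G := by
    refine ((integrable_exp_neg_mul_sq (b := 2 * b) (by positivity)).mul_const ‖x‖).mono'
      (by fun_prop) (ae_of_all _ fun t => ?_)
    simp only [G, norm_smul, hen, V.norm_op, Complex.norm_real, Real.norm_eq_abs, Real.abs_exp,
      one_mul, le_refl]
  have hGG : ∀ a t, ⟪G a, G (t + a)⟫_ℂ = (Real.exp (-(4 * b) * (a + t / 2) ^ 2) : ℂ) * F t := by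
    intro a t
    simp only [G, F, inner_smul_left, inner_smul_right, V.inner_op_op_eq_sub,
      Complex.conj_ofReal]
    have h1 : (starRingEnd ℂ) (e a) * e (t + a) = e t := by
      simp only [e, ← Complex.exp_conj, ← Complex.exp_add, map_mul, Complex.conj_ofReal,
        Complex.conj_I]
      congr 1
      push_cast
      ring
    have h2 : (Real.exp (-(2 * b) * a ^ 2) : ℂ) * Real.exp (-(2 * b) * (t + a) ^ 2)
        = Real.exp (-(4 * b) * (a + t / 2) ^ 2) * Real.exp (-b * t ^ 2) := by
      rw [← Complex.ofReal_mul, ← Complex.ofReal_mul, ← Real.exp_add, ← Real.exp_add]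
      congr 2
      ring
    rw [show -(t + a) - -a = -t by ring]
    linear_combination (⟪x, V.op (-t) x⟫_ℂ * (Real.exp (-(2 * b) * a ^ 2) : ℂ) *
      Real.exp (-(2 * b) * (t + a) ^ 2)) * h1 + ⟪x, V.op (-t) x⟫_ℂ * e t * h2
  have hgauss : ∀ t : ℝ, ∫ a : ℝ, Real.exp (-(4 * b) * (a + t / 2) ^ 2) = √(Real.pi / (4 * b)) :=
    fun t => by
      rw [integral_add_right_eq_self fun a : ℝ => Real.exp (-(4 * b) * a ^ 2), integral_gaussian]
  have hgi : ∀ t : ℝ, Integrable fun a : ℝ => Real.exp (-(4 * b) * (a + t / 2) ^ 2) := fun t =>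
    (integrable_exp_neg_mul_sq h4b).comp_add_right (t / 2)
  have hprod : Integrable (Function.uncurry fun a t : ℝ =>
      (Real.exp (-(4 * b) * (a + t / 2) ^ 2) : ℂ) * F t) (volume.prod volume) := by
    rw [integrable_prod_iff' (Continuous.aestronglyMeasurable (by fun_prop))]
    refine ⟨ae_of_all _ fun t => (hgi t).ofReal.mul_const (F t), ?_⟩
    simp only [Function.uncurry, norm_mul, Complex.norm_real, Real.norm_eq_abs, Real.abs_exp,
      integral_mul_const, hgauss]
    exact hFi.norm.const_mul _
  have key : ((‖∫ a, G a‖ ^ 2 : ℝ) : ℂ) = √(Real.pi / (4 * b)) * ∫ t, F t := by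
    have h1 : ((‖∫ a, G a‖ ^ 2 : ℝ) : ℂ) = ∫ a, ∫ t, ⟪G a, G t⟫_ℂ := by
      simp only [integral_inner hGi]
      simp only [← inner_conj_symm (𝕜 := ℂ) (G _) (∫ a, G a)]
      rw [integral_conj, integral_inner hGi, inner_conj_symm, inner_self_eq_norm_sq_to_K]
      simp
    rw [h1]
    calc ∫ a, ∫ t, ⟪G a, G t⟫_ℂ = ∫ a, ∫ t, ⟪G a, G (t + a)⟫_ℂ := by
          congr 1
          ext a
          exact (integral_add_right_eq_self (fun t => ⟪G a, G t⟫_ℂ) a).symm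
      _ = ∫ t, ∫ a, (Real.exp (-(4 * b) * (a + t / 2) ^ 2) : ℂ) * F t := by
          simp only [hGG]
          exact integral_integral_swap hprod
      _ = _ := by
          simp only [integral_mul_const, integral_complex_ofReal, hgauss, integral_const_mul]
  have hpos : 0 < √(Real.pi / (4 * b)) := by positivity
  refine ⟨‖∫ a, G a‖ ^ 2 / √(Real.pi / (4 * b)), by positivity, ?_⟩
  rw [Complex.ofReal_div, key, mul_div_cancel_left₀ _ (by exact_mod_cast hpos.ne'),
    Real.fourier_real_eq_integral_exp_smul]
  rfl

/-- Gaussian damping makes the coefficient integrable with nonnegative Fourier transform, hence a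
characteristic function; Lévy's continuity theorem removes the damping. The sign in `op (-t)`
matches `e^{+itr}` in `charFun` with `e^{-isr}` in the spectral measure. -/
theorem exists_measure_of_norm_eq_one (V : UnitaryGroup H) {x : H} (hx : ‖x‖ = 1) :
    ∃ ν : Measure ℝ, IsProbabilityMeasure ν ∧ ∀ t, charFun ν t = ⟪x, V.op (-t) x⟫_ℂ := by
  have hVc : Continuous fun t : ℝ => ⟪x, V.op (-t) x⟫_ℂ :=
    continuous_const.inner ((V.continuous x).comp continuous_neg)
  have h : ∀ n : ℕ, ∃ ν : Measure ℝ, IsProbabilityMeasure ν ∧ ∀ t, charFun ν t =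
      (Real.exp (-((n : ℝ) + 1)⁻¹ * t ^ 2) : ℂ) * ⟪x, V.op (-t) x⟫_ℂ := by
    intro n
    have hb : (0 : ℝ) < ((n : ℝ) + 1)⁻¹ := by positivity
    choose g hg0 hg using V.fourier_gaussian_mul_inner_nonneg x hb
    have hc : Continuous fun t : ℝ =>
      (Real.exp (-((n : ℝ) + 1)⁻¹ * t ^ 2) : ℂ) * ⟪x, V.op (-t) x⟫_ℂ := by fun_prop
    refine exists_charFun_eq_of_fourier_nonneg hc ?_ ?_ hg hg0
    · refine (integrable_exp_neg_mul_sq hb).mono' hc.aestronglyMeasurable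
        (ae_of_all _ fun t => ?_)
      rw [norm_mul, Complex.norm_real, Real.norm_eq_abs, Real.abs_exp]
      refine mul_le_of_le_one_right (Real.exp_pos _).le ?_
      exact (norm_inner_le_norm _ _).trans_eq (by rw [V.norm_op, hx, one_mul])
    · simp [V.map_zero, hx]
  choose ν hν hνt using h
  refine exists_charFun_eq_of_tendsto (μ := ν) hVc.continuousAt fun t => ?_
  simp only [hνt]
  have hcast : Tendsto (fun n : ℕ => (n : ℝ) + 1) atTop atTop :=
    tendsto_atTop_add_const_right _ _ tendsto_natCast_atTop_atTop
  have h1 : Tendsto (fun n : ℕ => Real.exp (-((n : ℝ) + 1)⁻¹ * t ^ 2)) atTop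
      (𝓝 (Real.exp (-0 * t ^ 2))) :=
    (Real.continuous_exp.tendsto _).comp
      (((tendsto_inv_atTop_zero.comp hcast).neg).mul_const _)
  have h2 := (Complex.continuous_ofReal.tendsto _).comp h1
  simpa [Function.comp_def] using h2.mul_const ⟪x, V.op (-t) x⟫_ℂ

/-- **Bochner's theorem** for the matrix coefficients of a unitary group. -/
theorem exists_spectralMeasure (V : UnitaryGroup H) (x : H) :
    ∃ μ : Measure ℝ, IsFiniteMeasure μ ∧
      ∀ s : ℝ, ⟪x, V.op s x⟫_ℂ = ∫ r, Complex.exp (-(Complex.I * s * r)) ∂μ := by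
  rcases eq_or_ne x 0 with rfl | hx
  · exact ⟨0, inferInstance, by simp⟩
  have hx' : ‖x‖ ≠ 0 := norm_ne_zero_iff.2 hx
  obtain ⟨ν, hν, h⟩ := V.exists_measure_of_norm_eq_one (x := ((‖x‖⁻¹ : ℝ) : ℂ) • x)
    (by rw [norm_smul, Complex.norm_real, norm_inv, norm_norm, inv_mul_cancel₀ hx'])
  refine ⟨(‖x‖₊ ^ 2) • ν, inferInstance, fun s => ?_⟩
  have h1 := h (-s)
  rw [charFun_apply_real, neg_neg, map_smul, inner_smul_left, inner_smul_right,
    Complex.conj_ofReal] at h1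
  have h2 : ∫ r, Complex.exp (-(Complex.I * s * r)) ∂ν
      = ∫ r : ℝ, Complex.exp (((-s : ℝ) : ℂ) * r * Complex.I) ∂ν := by
    congr 1
    ext r
    congr 1
    push_cast
    ring
  have h3 : (‖x‖ : ℂ) ≠ 0 := by exact_mod_cast hx'
  rw [integral_smul_nnreal_measure, NNReal.smul_def, h2, h1, Complex.real_smul]
  push_cast
  field_simp

/-- By Bochner's theorem the default value `0` in `spectralMeasure` is never a fallback. Only the
defining properties of the chosen measure are used below, so its uniqueness plays no role. -/
theorem isFiniteMeasure_spectralMeasure (V : UnitaryGroup H) (x : H) :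
    IsFiniteMeasure (V.spectralMeasure x) := by
  rw [spectralMeasure, dif_pos (V.exists_spectralMeasure x)]
  exact (V.exists_spectralMeasure x).choose_spec.1

theorem inner_op_eq_integral (V : UnitaryGroup H) (x : H) (s : ℝ) :
    ⟪x, V.op s x⟫_ℂ = ∫ r, Complex.exp (-(Complex.I * s * r)) ∂(V.spectralMeasure x) := by
  rw [spectralMeasure, dif_pos (V.exists_spectralMeasure x)]
  exact (V.exists_spectralMeasure x).choose_spec.2 s

theorem measureReal_spectralMeasure_univ (V : UnitaryGroup H) (x : H) :
    (V.spectralMeasure x).real Set.univ = ‖x‖ ^ 2 := by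
  have h := V.inner_op_eq_integral x 0
  simp only [V.map_zero, one_apply_eq_self, inner_self_eq_norm_sq_to_K] at h
  simp at h
  exact_mod_cast h.symm

/-- Expanding the square gives `2‖x‖² - 2 Re ⟪x, V_s x⟫`, and the real part of the spectral integral
has integrand `cos (s r)`. -/
theorem norm_op_sub_sq (V : UnitaryGroup H) (x : H) (s : ℝ) :
    ‖V.op s x - x‖ ^ 2 = ∫ r, (2 - 2 * Real.cos (s * r)) ∂(V.spectralMeasure x) := by
  have := V.isFiniteMeasure_spectralMeasure x
  have hint : Integrable (fun r : ℝ => Complex.exp (-(Complex.I * s * r)))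
      (V.spectralMeasure x) := by
    refine (integrable_const (1 : ℝ)).mono' (by fun_prop) (ae_of_all _ fun r => ?_)
    rw [show -(Complex.I * s * r) = ((-(s * r) : ℝ) : ℂ) * Complex.I by push_cast; ring,
      Complex.norm_exp_ofReal_mul_I]
  have hcos : (⟪x, V.op s x⟫_ℂ).re = ∫ r, Real.cos (s * r) ∂(V.spectralMeasure x) := by
    rw [V.inner_op_eq_integral, ← RCLike.re_eq_complex_re, ← integral_re hint]
    congr 1
    ext r
    rw [show -(Complex.I * s * r) = ((-(s * r) : ℝ) : ℂ) * Complex.I by push_cast; ring,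
      RCLike.re_eq_complex_re, Complex.exp_ofReal_mul_I_re, Real.cos_neg]
  have hcosi : Integrable (fun r => Real.cos (s * r)) (V.spectralMeasure x) :=
    (integrable_const (1 : ℝ)).mono' (by fun_prop)
      (ae_of_all _ fun r => Real.abs_cos_le_one _)
  rw [integral_sub (integrable_const _) (hcosi.const_mul _), integral_const, integral_const_mul,
    ← hcos, V.measureReal_spectralMeasure_univ, norm_sub_sq (𝕜 := ℂ), V.norm_op,
    ← inner_conj_symm, RCLike.conj_re, RCLike.re_eq_complex_re, smul_eq_mul]
  ring

/-- A vector in the domain of the generator has a finite second moment. -/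
theorem integrable_sq_spectralMeasure (V : UnitaryGroup H) {x : H} (hx : x ∈ V.generator.domain) :
    Integrable (fun r : ℝ => r ^ 2) (V.spectralMeasure x) := by
  have := V.isFiniteMeasure_spectralMeasure x
  have hd : HasDerivAt (fun s => V.op s x) (deriv (fun s => V.op s x) 0) 0 :=
    DifferentiableAt.hasDerivAt hx
  set d := deriv (fun s => V.op s x) 0
  let s : ℕ → ℝ := fun n => ((n : ℝ) + 1)⁻¹
  have hs : Tendsto s atTop (𝓝[≠] 0) := by
    refine tendsto_nhdsWithin_iff.2 ⟨tendsto_inv_atTop_zero.comp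
      (tendsto_atTop_add_const_right _ _ tendsto_natCast_atTop_atTop), ?_⟩
    exact Eventually.of_forall fun n => inv_ne_zero (by positivity)
  have hs0 : ∀ n, s n ≠ 0 := fun n => inv_ne_zero (by positivity)
  have h1 : Tendsto (fun n => ‖(s n)⁻¹ • (V.op (s n) x - x)‖ ^ 2) atTop (𝓝 (‖d‖ ^ 2)) := by
    have := (hasDerivAt_iff_tendsto_slope.1 hd).comp hs
    simp only [Function.comp_def, slope_def_module, sub_zero, V.map_zero,
      one_apply_eq_self] at this
    exact this.norm.pow 2
  -- `G n r = |e^{-i s r} - 1|² / s²` tends to `r²`, while its integral is the squared norm of a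
  -- difference quotient, convergent on the domain. Fatou's lemma concludes.
  let G : ℕ → ℝ → ℝ := fun n r => ((s n)⁻¹) ^ 2 * (2 - 2 * Real.cos (s n * r))
  have hG0 : ∀ n r, 0 ≤ G n r := fun n r =>
    mul_nonneg (sq_nonneg _) (by linarith [Real.cos_le_one (s n * r)])
  have hGi : ∀ n, Integrable (G n) (V.spectralMeasure x) := fun n => by
    refine (integrable_const ((((s n)⁻¹) ^ 2) * 4)).mono' (by fun_prop) (ae_of_all _ fun r => ?_)
    rw [Real.norm_of_nonneg (hG0 n r)]
    exact mul_le_mul_of_nonneg_left (by linarith [Real.neg_one_le_cos (s n * r)]) (sq_nonneg _)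
  have hGint : ∀ n, ∫ r, G n r ∂(V.spectralMeasure x) = ‖(s n)⁻¹ • (V.op (s n) x - x)‖ ^ 2 :=
    fun n => by
      rw [integral_const_mul, ← V.norm_op_sub_sq, norm_smul, mul_pow, Real.norm_eq_abs, sq_abs]
  refine integrable_of_tendsto (G := G) (ae_of_all _ fun r => ?_)
    (fun n => (hGi n).aestronglyMeasurable) ?_
  -- Since `2 - 2 cos (s r) = (2 sin (s r / 2))²`, the limit is the square of a derivative at `0`.
  · have hsin : HasDerivAt (fun u : ℝ => 2 * Real.sin (u * r / 2)) r 0 := by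
      have h2 : HasDerivAt (fun u : ℝ => u * r / 2) (r / 2) 0 := by
        simpa using ((hasDerivAt_id (0 : ℝ)).mul_const r).div_const 2
      have := (h2.sin).const_mul 2
      simpa [mul_div_cancel₀] using this
    have h3 := ((hasDerivAt_iff_tendsto_slope.1 hsin).comp hs).pow 2
    refine h3.congr fun n => ?_
    simp only [Function.comp_def, slope_def_module, sub_zero, zero_mul, zero_div, Real.sin_zero,
      mul_zero, smul_eq_mul, G]
    have h4 := Real.cos_sq' (s n * r / 2)
    have h5 := Real.cos_two_mul (s n * r / 2)
    rw [show 2 * (s n * r / 2) = s n * r by ring] at h5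
    rw [h5, h4]
    ring
  · have h2 : ∀ n, ∫⁻ r, ‖G n r‖ₑ ∂(V.spectralMeasure x)
        = ENNReal.ofReal (∫ r, G n r ∂(V.spectralMeasure x)) := fun n => by
      rw [ofReal_integral_eq_lintegral_ofReal (hGi n) (ae_of_all _ (hG0 n))]
      exact lintegral_congr fun r => Real.enorm_of_nonneg (hG0 n r)
    simp only [h2, hGint]
    rw [(ENNReal.tendsto_ofReal h1).liminf_eq]
    exact ENNReal.ofReal_ne_top

/-- This is `2 - 2 cos u ≤ u²` under the spectral integral. -/
theorem norm_op_sub_le (V : UnitaryGroup H) {x : H} (hx : x ∈ V.generator.domain) (s : ℝ) :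
    ‖V.op s x - x‖ ≤ |s| * √(∫ r, r ^ 2 ∂(V.spectralMeasure x)) := by
  have := V.isFiniteMeasure_spectralMeasure x
  refine abs_le_of_sq_le_sq' ?_ (by positivity) |>.2
  rw [mul_pow, sq_abs, Real.sq_sqrt (integral_nonneg fun r => sq_nonneg r), V.norm_op_sub_sq,
    ← integral_const_mul]
  refine integral_mono_of_nonneg (ae_of_all _ fun r => ?_)
    ((V.integrable_sq_spectralMeasure hx).const_mul _) (ae_of_all _ fun r => ?_)
  · simp only [Pi.zero_apply]
    linarith [Real.cos_le_one (s * r)]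
  · have := Real.one_sub_sq_div_two_le_cos (x := s * r)
    simp only
    nlinarith

/-- The measure has mass `‖x‖²`, so the integral defining the deviation is `∫ r² - ‖x‖² ⟨O⟩²`; for
`‖x‖ ≤ 1` at most `⟨O⟩²` has been subtracted. -/
theorem integral_sq_le_mean_sq_add_deviation_sq (V : UnitaryGroup H) {x : H}
    (hx : x ∈ V.generator.domain) (hx1 : ‖x‖ ≤ 1) :
    ∫ r, r ^ 2 ∂(V.spectralMeasure x) ≤ V.mean x ^ 2 + V.deviation x ^ 2 := by
  have := V.isFiniteMeasure_spectralMeasure x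
  have h1 : ∫ r, (r ^ 2 - V.mean x ^ 2) ∂(V.spectralMeasure x) ≤ V.deviation x ^ 2 := by
    rw [deviation]
    -- If the integral were negative, the square root would be `0` and the bound trivial; its sign
    -- need not be settled.
    rcases le_total 0 (∫ r, (r ^ 2 - V.mean x ^ 2) ∂(V.spectralMeasure x)) with h | h
    · rw [Real.sq_sqrt h]
    · exact h.trans (sq_nonneg _)
  rw [integral_sub (V.integrable_sq_spectralMeasure hx) (integrable_const _), integral_const,
    V.measureReal_spectralMeasure_univ, smul_eq_mul] at h1
  have h2 : ‖x‖ ^ 2 ≤ 1 := pow_le_one₀ (norm_nonneg _) hx1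
  nlinarith [mul_le_mul_of_nonneg_right h2 (sq_nonneg (V.mean x))]

/-- The group acts on an eigenvector of its generator by a phase. -/
theorem op_apply_of_mem_eigenspace (V : UnitaryGroup H) {m : ℝ} {x : H}
    (hx : x ∈ eigenspace V.generator (m : ℂ)) (s : ℝ) :
    V.op s x = Complex.exp (-(Complex.I * m * s)) • x := by
  obtain ⟨hdom, heq⟩ := hx
  have hd : HasDerivAt (fun s => V.op s x) (deriv (fun s => V.op s x) 0) 0 :=
    DifferentiableAt.hasDerivAt hdom
  have hd0 : deriv (fun s => V.op s x) 0 = -(Complex.I * m) • x := by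
    have h1 : Complex.I • deriv (fun s => V.op s x) 0 = (m : ℂ) • x := heq
    have h2 := congrArg (fun y => -Complex.I • y) h1
    simp only [smul_smul, neg_mul, Complex.I_mul_I, neg_neg, one_smul] at h2
    exact h2
  rw [hd0] at hd
  -- The group law carries the derivative at `0` to every `t`; multiplying by `e^{ims}` then gives a
  -- function with zero derivative.
  have hds : ∀ t, HasDerivAt (fun s => V.op s x) (-(Complex.I * m) • V.op t x) t := by
    intro t
    have h1 : HasDerivAt (fun s => V.op (s - t) x) (-(Complex.I * m) • x) t := by
      have hd' : HasDerivAt (fun s => V.op s x) (-(Complex.I * m) • x) (t - t) := by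
        rwa [sub_self]
      exact hd'.comp_sub_const t t
    have h2 := ((V.op t).restrictScalars ℝ).hasFDerivAt.comp_hasDerivAt t h1
    simp only [ContinuousLinearMap.coe_restrictScalars', map_smul] at h2
    refine h2.congr_of_eventuallyEq (Eventually.of_forall fun s => ?_)
    simp only [Function.comp_apply]
    rw [← mul_apply_eq_comp, ← V.map_add, add_sub_cancel]
  have hexp : ∀ t : ℝ, HasDerivAt (fun s : ℝ => Complex.exp (Complex.I * m * s))
      (Complex.exp (Complex.I * m * t) * (Complex.I * m)) t := fun t => by
    have h1 : HasDerivAt (fun s : ℝ => Complex.I * m * (s : ℂ)) (Complex.I * m) t := by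
      simpa using (Complex.ofRealCLM.hasDerivAt (x := t)).const_mul (Complex.I * m)
    exact h1.cexp
  have hconst : ∀ t, HasDerivAt (fun s : ℝ => Complex.exp (Complex.I * m * s) • V.op s x) 0 t := by
    intro t
    have h := (hexp t).smul (hds t)
    convert! h using 1
    module
  have h := is_const_of_deriv_eq_zero (fun t => (hconst t).differentiableAt)
    (fun t => (hconst t).deriv) s 0
  simp only [Complex.ofReal_zero, mul_zero, Complex.exp_zero, one_smul, V.map_zero,
    one_apply_eq_self] at h
  conv_rhs => rw [← h]
  rw [smul_smul, ← Complex.exp_add, neg_add_cancel, Complex.exp_zero, one_smul]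

end UnitaryGroup

/-! ### Orthogonal eigenspaces, block-diagonal parts and traces -/

section BlockDiagonal

variable {H : Type u} [NormedAddCommGroup H] [InnerProductSpace ℂ H]

/-- **Bessel's inequality** for an orthogonal family of closed subspaces. -/
theorem sum_norm_sq_starProjection_le {ι : Type*} {K : ι → Submodule ℂ H}
    [∀ i, (K i).HasOrthogonalProjection]
    (hK : OrthogonalFamily ℂ (fun i => K i) fun i => (K i).subtypeₗᵢ) (x : H) (F : Finset ι) :
    ∑ i ∈ F, ‖(K i).starProjection x‖ ^ 2 ≤ ‖x‖ ^ 2 := by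
  -- Both `‖v‖²` and `⟪v, x⟫` equal the sum, so Cauchy–Schwarz yields `‖v‖ ≤ ‖x‖`.
  set v := ∑ i ∈ F, (K i).starProjection x with hv
  have h1 : ‖v‖ ^ 2 = ∑ i ∈ F, ‖(K i).starProjection x‖ ^ 2 :=
    hK.norm_sum (fun i => ⟨(K i).starProjection x, Submodule.starProjection_apply_mem _ x⟩) F
  have h2 : ((∑ i ∈ F, ‖(K i).starProjection x‖ ^ 2 : ℝ) : ℂ) = ⟪v, x⟫_ℂ := by
    rw [hv, sum_inner]
    push_cast
    refine Finset.sum_congr rfl fun i _ => ?_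
    have h := inner_self_eq_norm_sq_to_K (𝕜 := ℂ) ((K i).starProjection x)
    rw [Submodule.inner_starProjection_left_eq_right,
      Submodule.starProjection_eq_self_iff.2 (Submodule.starProjection_apply_mem _ x),
      ← Submodule.inner_starProjection_left_eq_right] at h
    exact h.symm
  have h3 : ∑ i ∈ F, ‖(K i).starProjection x‖ ^ 2 ≤ ‖v‖ * ‖x‖ := by
    have h := norm_inner_le_norm (𝕜 := ℂ) v x
    rw [← h2, Complex.norm_real] at h
    exact (Real.le_norm_self _).trans h
  rw [← h1] at h3 ⊢
  rcases (norm_nonneg v).eq_or_lt with h | h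
  · rw [← h, zero_pow two_ne_zero]
    exact sq_nonneg _
  · have : ‖v‖ ≤ ‖x‖ := le_of_mul_le_mul_left (by rwa [sq] at h3) h
    gcongr

theorem HasTrace.sum_smul {ι : Type*} {F : Finset ι} {a : ι → ℂ} {R : ι → H →L[ℂ] H}
    {B : H →L[ℂ] H} {t : ι → ℂ} (h : ∀ i ∈ F, HasTrace (R i * B) (t i)) :
    HasTrace ((∑ i ∈ F, a i • R i) * B) (∑ i ∈ F, a i * t i) := by
  intro J e
  have h1 := hasSum_sum fun i hi => (h i hi J e).mul_left (a i)
  convert! h1 using 1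
  ext j
  simp only [Finset.sum_mul, sum_apply, inner_sum, smul_mul_assoc,
    smul_apply, inner_smul_right]

variable [CompleteSpace H]

/-- The block-diagonal part of a bounded operator with respect to an orthogonal family of closed
subspaces converges strongly to a bounded operator. -/
theorem exists_hasSum_starProjection_comp {ι : Type*} {K : ι → Submodule ℂ H}
    [∀ i, (K i).HasOrthogonalProjection]
    (hK : OrthogonalFamily ℂ (fun i => K i) fun i => (K i).subtypeₗᵢ) (A : H →L[ℂ] H) :
    ∃ B : H →L[ℂ] H, ∀ x : H,
      HasSum (fun i => (K i).starProjection (A ((K i).starProjection x))) (B x) := by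
  let f : H → ∀ i, K i := fun x i =>
    ⟨(K i).starProjection (A ((K i).starProjection x)), Submodule.starProjection_apply_mem _ _⟩
  -- Bessel's inequality bounds the squared norms of the terms. By orthogonality this gives
  -- summability, and the same bound gives operator norm at most `‖A‖`.
  have hb : ∀ x (F : Finset ι), ∑ i ∈ F, ‖f x i‖ ^ 2 ≤ (‖A‖ * ‖x‖) ^ 2 := fun x F =>
    calc ∑ i ∈ F, ‖f x i‖ ^ 2 ≤ ∑ i ∈ F, ‖A‖ ^ 2 * ‖(K i).starProjection x‖ ^ 2 := by
          refine Finset.sum_le_sum fun i _ => ?_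
          rw [← mul_pow]
          gcongr
          exact ((K i).norm_starProjection_apply_le _).trans (A.le_opNorm _)
      _ ≤ (‖A‖ * ‖x‖) ^ 2 := by
          rw [← Finset.mul_sum, mul_pow]
          gcongr
          exact sum_norm_sq_starProjection_le hK x F
  have hs : ∀ x, Summable fun i => (K i).starProjection (A ((K i).starProjection x)) := fun x =>
    (hK.summable_iff_norm_sq_summable (f x)).2
      (summable_of_sum_le (fun i => sq_nonneg _) (hb x))
  let L : H →ₗ[ℂ] H :=
    { toFun := fun x => ∑' i, (K i).starProjection (A ((K i).starProjection x))
      map_add' := fun x y => by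
        simp only [map_add]
        exact (hs x).tsum_add (hs y)
      map_smul' := fun a x => by
        simp only [map_smul, RingHom.id_apply]
        exact (hs x).tsum_const_smul a }
  refine ⟨L.mkContinuous ‖A‖ fun x => ?_, fun x => (hs x).hasSum⟩
  refine le_of_tendsto (hs x).hasSum.norm (Eventually.of_forall fun F => ?_)
  have h := hK.norm_sum (f x) F
  have h2 := hb x F
  rw [← h] at h2
  exact abs_le_of_sq_le_sq' h2 (by positivity) |>.2

/-- Symmetry makes eigenvectors for distinct real eigenvalues orthogonal, and orthogonality passes
to closures, on which `eigenprojection` is based. -/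
theorem orthogonalFamily_topologicalClosure_eigenspace {T : H →ₗ.[ℂ] H} (hT : IsSelfAdjoint T)
    {σ : Set ℂ} (hσ : ∀ z ∈ σ, ∃ m : ℝ, z = m) :
    OrthogonalFamily ℂ (fun z : σ => (eigenspace T z).topologicalClosure)
      fun z => (eigenspace T z).topologicalClosure.subtypeₗᵢ := by
  have hsymm : ∀ x y : T.domain, ⟪T x, (y : H)⟫_ℂ = ⟪(x : H), T y⟫_ℂ := by
    have h := T.adjoint_isFormalAdjoint hT.dense_domain
    rw [LinearPMap.isSelfAdjoint_def.1 hT] at h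
    exact fun x y => h x y
  refine OrthogonalFamily.of_pairwise fun z w hzw => ?_
  have horth : eigenspace T z ⟂ eigenspace T w := by
    rw [Submodule.isOrtho_iff_inner_eq]
    rintro x ⟨hx, ex⟩ y ⟨hy, ey⟩
    obtain ⟨m, hm⟩ := hσ z z.2
    have h := hsymm ⟨x, hx⟩ ⟨y, hy⟩
    rw [ex, ey, inner_smul_left, inner_smul_right, hm, Complex.conj_ofReal, ← hm] at h
    by_contra h0
    exact hzw (Subtype.ext (mul_right_cancel₀ h0 h))
  have h1 : (eigenspace T z).topologicalClosure ≤ (eigenspace T w)ᗮ :=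
    Submodule.topologicalClosure_minimal _ horth (Submodule.isClosed_orthogonal _)
  rwa [← Submodule.orthogonal_closure] at h1

/-- Parseval's identity for `B* v` and `u`, valid in every Hilbert basis. -/
theorem hasTrace_rankOne_mul (u v : H) (B : H →L[ℂ] H) :
    HasTrace (InnerProductSpace.rankOne ℂ u v * B) ⟪v, B u⟫_ℂ := by
  intro J e
  have h := e.hasSum_inner_mul_inner (ContinuousLinearMap.adjoint B v) u
  rw [ContinuousLinearMap.adjoint_inner_left] at h
  convert! h using 2 with j
  rw [ContinuousLinearMap.adjoint_inner_left, mul_apply_eq_comp,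
    InnerProductSpace.rankOne_apply, inner_smul_right]

end BlockDiagonal

/-! ### Averages of oscillating phases -/

section Oscillation

/-- The primitive `e^{iωt}/(iω)` has modulus `1/|ω|`, so the bound is uniform in `T`; dividing by
`T` yields the decay of the off-diagonal terms. -/
theorem norm_intervalIntegral_exp_le {ω : ℝ} (hω : ω ≠ 0) (T : ℝ) :
    ‖∫ t in (0 : ℝ)..T, Complex.exp (Complex.I * ω * t)‖ ≤ 2 / |ω| := by
  have hc : Complex.I * (ω : ℂ) ≠ 0 := mul_ne_zero Complex.I_ne_zero (by exact_mod_cast hω)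
  rw [integral_exp_mul_complex hc, norm_div, norm_mul, Complex.norm_I, one_mul, Complex.norm_real,
    Real.norm_eq_abs]
  gcongr
  refine (norm_sub_le _ _).trans ?_
  rw [show Complex.I * (ω : ℂ) * (T : ℂ) = ((ω * T : ℝ) : ℂ) * Complex.I by push_cast; ring,
    Complex.norm_exp_ofReal_mul_I]
  norm_num

end Oscillation

/-! ### Finite superpositions of masses and the time-average estimate -/

namespace Superposition

variable {H : Type u} [NormedAddCommGroup H] [InnerProductSpace ℂ H] [CompleteSpace H]
  {Q : MassSystem H} (Ψ : Superposition Q)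

theorem mem_spectrum {M : ℝ} (hM : M ∈ Ψ.S) : (M : ℂ) ∈ spectrum Q.mass := by
  rw [Q.spectrum_mass]
  exact Ψ.mem_pointSpectrum M hM

theorem _root_.MassSuperselection.MassSystem.orthogonalFamily (Q : MassSystem H) :
    OrthogonalFamily ℂ (fun z : spectrum Q.mass => (eigenspace Q.mass z).topologicalClosure)
      fun z => (eigenspace Q.mass z).topologicalClosure.subtypeₗᵢ :=
  orthogonalFamily_topologicalClosure_eigenspace Q.mass_selfAdjoint fun z hz =>
    let ⟨m, _, h⟩ := Q.spectrum_mass_pos z hz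
    ⟨m, h⟩

theorem comp_mem_closure {M : ℝ} (hM : M ∈ Ψ.S) :
    Ψ.comp M ∈ (eigenspace Q.mass (M : ℂ)).topologicalClosure :=
  Submodule.le_topologicalClosure _ (Ψ.comp_mem_eigenspace M hM)

theorem inner_comp_of_ne {M M' : ℝ} (hM : M ∈ Ψ.S) (hM' : M' ∈ Ψ.S) (h : M ≠ M') :
    ⟪Ψ.comp M, Ψ.comp M'⟫_ℂ = 0 :=
  Q.orthogonalFamily (i := ⟨M, Ψ.mem_spectrum hM⟩) (j := ⟨M', Ψ.mem_spectrum hM'⟩)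
    (fun h0 => h (Complex.ofReal_injective (congrArg Subtype.val h0)))
    ⟨_, Ψ.comp_mem_closure hM⟩ ⟨_, Ψ.comp_mem_closure hM'⟩

/-- Orthogonality gives `⟪Ψ_M, Ψ⟫ = ‖Ψ_M‖²`; Cauchy–Schwarz with `‖Ψ‖ = 1` does the rest. -/
theorem norm_comp_le_one {M : ℝ} (hM : M ∈ Ψ.S) : ‖Ψ.comp M‖ ≤ 1 := by
  have h1 : ⟪Ψ.comp M, Ψ.vec⟫_ℂ = (‖Ψ.comp M‖ : ℂ) ^ 2 := by
    rw [vec, inner_sum, Finset.sum_eq_single_of_mem M hM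
      fun M' hM' h => Ψ.inner_comp_of_ne hM hM' h.symm, inner_self_eq_norm_sq_to_K]
    rfl
  have h2 := norm_inner_le_norm (𝕜 := ℂ) (Ψ.comp M) Ψ.vec
  have h3 : ‖Ψ.vec‖ = 1 := Ψ.norm_sum
  rw [h1, h3, mul_one, norm_pow, Complex.norm_real, norm_norm] at h2
  nlinarith [norm_nonneg (Ψ.comp M)]

/-- The block-diagonal part of `A` has the same diagonal matrix elements in the components. -/
theorem inner_comp_blockDiagonalPart {A B : H →L[ℂ] H} (hB : IsBlockDiagonalPart Q.mass A B)
    {M : ℝ} (hM : M ∈ Ψ.S) : ⟪Ψ.comp M, B (Ψ.comp M)⟫_ℂ = ⟪Ψ.comp M, A (Ψ.comp M)⟫_ℂ := by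
  let z : spectrum Q.mass := ⟨M, Ψ.mem_spectrum hM⟩
  have hz : eigenprojection Q.mass z (Ψ.comp M) = Ψ.comp M :=
    Submodule.starProjection_eq_self_iff.2 (Ψ.comp_mem_closure hM)
  have h0 : ∀ w : spectrum Q.mass, w ≠ z →
      eigenprojection Q.mass w (A (eigenprojection Q.mass w (Ψ.comp M))) = 0 := fun w hw => by
    have : eigenprojection Q.mass w (Ψ.comp M) = 0 := by
      rw [eigenprojection, Submodule.starProjection_apply_eq_zero_iff, Submodule.mem_orthogonal]
      exact fun u hu => Q.orthogonalFamily hw ⟨u, hu⟩ ⟨_, Ψ.comp_mem_closure hM⟩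
    rw [this, map_zero, map_zero]
  rw [(hB (Ψ.comp M)).unique (hasSum_single z h0), hz, eigenprojection,
    ← Submodule.inner_starProjection_left_eq_right]
  congr 1

theorem hasTrace_mixture {A B : H →L[ℂ] H} (hB : IsBlockDiagonalPart Q.mass A B) :
    HasTrace (Ψ.mixture * B) (Ψ.diagonalValue A) := by
  have h := HasTrace.sum_smul (F := Ψ.S) (B := B)
    (a := fun M => ((‖Ψ.comp M‖ ^ 2 : ℝ) : ℂ)) fun M _ => hasTrace_rankOne_mul
      (((‖Ψ.comp M‖⁻¹ : ℝ) : ℂ) • Ψ.comp M) (((‖Ψ.comp M‖⁻¹ : ℝ) : ℂ) • Ψ.comp M) B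
  convert! h using 1
  refine Finset.sum_congr rfl fun M hM => ?_
  rw [← Ψ.inner_comp_blockDiagonalPart hB hM, map_smul, inner_smul_left, inner_smul_right,
    Complex.conj_ofReal]
  -- The weight `‖Ψ_M‖²` cancels the two normalising factors; a vanishing component contributes `0`
  -- on both sides.
  rcases eq_or_ne (Ψ.comp M) 0 with h0 | h0
  · simp [h0]
  · have h1 : (‖Ψ.comp M‖ : ℂ) ≠ 0 := by exact_mod_cast norm_ne_zero_iff.2 h0
    push_cast
    field_simp

theorem E_nonneg : 0 ≤ Ψ.E := by
  refine Real.sSup_nonneg ?_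
  rintro _ ⟨M, _, rfl⟩
  exact Real.sqrt_nonneg _

theorem δM_nonneg : 0 ≤ Ψ.δM := by
  refine Real.sInf_nonneg ?_
  rintro _ ⟨M, _, M', _, _, rfl⟩
  exact abs_nonneg _

theorem δM_le {M M' : ℝ} (hM : M ∈ Ψ.S) (hM' : M' ∈ Ψ.S) (h : M ≠ M') : Ψ.δM ≤ |M - M'| := by
  refine csInf_le ⟨0, ?_⟩ ⟨M, hM, M', hM', h, rfl⟩
  rintro _ ⟨M, _, M', _, _, rfl⟩
  exact abs_nonneg _

theorem δM_pos {M M' : ℝ} (hM : M ∈ Ψ.S) (hM' : M' ∈ Ψ.S) (h : M ≠ M') : 0 < Ψ.δM := by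
  set D := {d | ∃ M ∈ Ψ.S, ∃ M' ∈ Ψ.S, M ≠ M' ∧ d = |M - M'|} with hD
  have hfin : D.Finite := by
    refine ((Ψ.S ×ˢ Ψ.S).finite_toSet.image fun p => |p.1 - p.2|).subset ?_
    rintro _ ⟨M, hM, M', hM', _, rfl⟩
    exact ⟨(M, M'), by simp [hM, hM'], rfl⟩
  obtain ⟨M, _, M', _, hne, h1⟩ := Set.Nonempty.csInf_mem (s := D) ⟨_, M, hM, M', hM', h, rfl⟩ hfin
  rw [δM, ← hD, h1]
  exact abs_pos.2 (sub_ne_zero.2 hne)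

theorem norm_expHam_sub_le {M : ℝ} (hM : M ∈ Ψ.S) (s : ℝ) :
    ‖Q.expHam.op s (Ψ.comp M) - Ψ.comp M‖ ≤ |s| * Ψ.E := by
  have hdom : Ψ.comp M ∈ Q.expHam.generator.domain := by
    rw [Q.expHam_generator]
    exact Ψ.comp_mem_domain M hM
  refine (Q.expHam.norm_op_sub_le hdom s).trans ?_
  gcongr
  refine (Real.sqrt_le_sqrt (Q.expHam.integral_sq_le_mean_sq_add_deviation_sq hdom
    (Ψ.norm_comp_le_one hM))).trans ?_
  exact le_csSup (Ψ.S.finite_toSet.image _).bddAbove ⟨M, hM, rfl⟩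

/-- Commutation lets the mass group act first, directly on an eigenvector, so invariance of the
eigenspaces under `e^{-isH}` is not needed. -/
theorem evolution_vec (t : ℝ) : Q.evolution t Ψ.vec =
    ∑ M ∈ Ψ.S, Complex.exp (-(Complex.I * M * (t * Q.c ^ 2 / Q.hbar : ℝ))) •
      Q.expHam.op (t / Q.hbar) (Ψ.comp M) := by
  rw [vec, map_sum]
  refine Finset.sum_congr rfl fun M hM => ?_
  have hmem : Ψ.comp M ∈ eigenspace Q.expMass.generator (M : ℂ) := by
    rw [Q.expMass_generator]
    exact Ψ.comp_mem_eigenspace M hM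
  rw [MassSystem.evolution, (Q.commute _ _).eq, mul_apply_eq_comp,
    Q.expMass.op_apply_of_mem_eigenspace hmem, map_smul]

/-- The expectation value at time `t` as a double sum over the masses. -/
theorem inner_evolution (A : H →L[ℂ] H) (t : ℝ) :
    ⟪Ψ.vec, ContinuousLinearMap.adjoint (Q.evolution t) (A (Q.evolution t Ψ.vec))⟫_ℂ =
      ∑ M ∈ Ψ.S, ∑ M' ∈ Ψ.S,
        Complex.exp (Complex.I * ((M - M') * (Q.c ^ 2 / Q.hbar) : ℝ) * t) *
          ⟪Q.expHam.op (t / Q.hbar) (Ψ.comp M), A (Q.expHam.op (t / Q.hbar) (Ψ.comp M'))⟫_ℂ := by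
  rw [ContinuousLinearMap.adjoint_inner_right, evolution_vec, map_sum, sum_inner]
  refine Finset.sum_congr rfl fun M _ => ?_
  rw [inner_sum]
  refine Finset.sum_congr rfl fun M' _ => ?_
  rw [map_smul, inner_smul_left, inner_smul_right, ← mul_assoc, ← Complex.exp_conj,
    ← Complex.exp_add]
  congr 2
  simp only [map_neg, map_mul, Complex.conj_I, Complex.conj_ofReal]
  push_cast
  ring

theorem continuous_inner_evolution (A : H →L[ℂ] H) : Continuous fun t : ℝ =>
    ⟪Ψ.vec, ContinuousLinearMap.adjoint (Q.evolution t) (A (Q.evolution t Ψ.vec))⟫_ℂ := by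
  simp only [inner_evolution]
  have h : ∀ M, Continuous fun t : ℝ => Q.expHam.op (t / Q.hbar) (Ψ.comp M) := fun M =>
    (Q.expHam.continuous (Ψ.comp M)).comp (continuous_id.div_const _)
  refine continuous_finsetSum _ fun M _ => continuous_finsetSum _ fun M' _ => ?_
  exact (by fun_prop : Continuous fun t : ℝ =>
    Complex.exp (Complex.I * ((M - M') * (Q.c ^ 2 / Q.hbar) : ℝ) * t)).mul
      ((h M).inner (A.continuous.comp (h M')))

/-- Changing one argument at a time costs `‖A‖ |s| E` each, as the evolution is isometric and the
components have norm at most `1`. -/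
theorem norm_inner_expHam_sub_le (A : H →L[ℂ] H) {M M' : ℝ} (hM : M ∈ Ψ.S) (hM' : M' ∈ Ψ.S)
    (s : ℝ) : ‖⟪Q.expHam.op s (Ψ.comp M), A (Q.expHam.op s (Ψ.comp M'))⟫_ℂ -
      ⟪Ψ.comp M, A (Ψ.comp M')⟫_ℂ‖ ≤ 2 * ‖A‖ * (|s| * Ψ.E) := by
  set x := Ψ.comp M
  set y := Ψ.comp M'
  set d := |s| * Ψ.E
  have hd : 0 ≤ d := mul_nonneg (abs_nonneg _) Ψ.E_nonneg
  have h1 : ⟪Q.expHam.op s x, A (Q.expHam.op s y)⟫_ℂ - ⟪x, A y⟫_ℂ =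
      ⟪Q.expHam.op s x - x, A (Q.expHam.op s y)⟫_ℂ + ⟪x, A (Q.expHam.op s y - y)⟫_ℂ := by
    rw [inner_sub_left, map_sub, inner_sub_right]
    ring
  have h2 : ‖⟪Q.expHam.op s x - x, A (Q.expHam.op s y)⟫_ℂ‖ ≤ d * (‖A‖ * 1) := by
    refine (norm_inner_le_norm _ _).trans ?_
    gcongr
    · exact Ψ.norm_expHam_sub_le hM s
    · refine A.le_opNorm_of_le ?_
      rw [Q.expHam.norm_op]
      exact Ψ.norm_comp_le_one hM'
  have h3 : ‖⟪x, A (Q.expHam.op s y - y)⟫_ℂ‖ ≤ 1 * (‖A‖ * d) := by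
    refine (norm_inner_le_norm _ _).trans ?_
    gcongr
    · exact Ψ.norm_comp_le_one hM
    · exact A.le_opNorm_of_le (Ψ.norm_expHam_sub_le hM' s)
  rw [h1]
  refine (norm_add_le _ _).trans ?_
  linarith

theorem norm_timeAverage_sub_le (A : H →L[ℂ] H) {T : ℝ} (hT : 0 < T) :
    ‖Ψ.timeAverage A T - Ψ.diagonalValue A‖ ≤ Ψ.lowerRatio A T + Ψ.upperRatio A T := by
  have hħ := Q.hbar_pos
  have hc := Q.c_pos
  have hE := Ψ.E_nonneg
  have hTC : (T : ℂ) ≠ 0 := by exact_mod_cast hT.ne'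
  let ω : ℝ → ℝ → ℝ := fun M M' => (M - M') * (Q.c ^ 2 / Q.hbar)
  let e : ℝ → ℝ → ℝ → ℂ := fun M M' t => Complex.exp (Complex.I * (ω M M') * t)
  have hec : ∀ M M', Continuous (e M M') := fun M M' => by fun_prop
  let f : ℝ → ℂ := fun t =>
    ⟪Ψ.vec, ContinuousLinearMap.adjoint (Q.evolution t) (A (Q.evolution t Ψ.vec))⟫_ℂ
  -- The expectation value with the `H`-evolution frozen at time `0`; only the mass phases remain.
  let D : ℝ → ℂ := fun t => ∑ M ∈ Ψ.S, ∑ M' ∈ Ψ.S, e M M' t * ⟪Ψ.comp M, A (Ψ.comp M')⟫_ℂ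
  have hfc : Continuous f := Ψ.continuous_inner_evolution A
  have hDc : Continuous D := by fun_prop
  have hfD : ‖∫ t in (0 : ℝ)..T, (f t - D t)‖ ≤
      (Ψ.N : ℝ) ^ 2 * (2 * ‖A‖ * (T / Q.hbar * Ψ.E)) * |T - 0| := by
    refine intervalIntegral.norm_integral_le_of_norm_le_const fun t ht => ?_
    rw [Set.uIoc_of_le hT.le] at ht
    simp only [f, inner_evolution, D, ← Finset.sum_sub_distrib]
    have hterm : ∀ M ∈ Ψ.S, ∀ M' ∈ Ψ.S, ‖e M M' t *
        ⟪Q.expHam.op (t / Q.hbar) (Ψ.comp M), A (Q.expHam.op (t / Q.hbar) (Ψ.comp M'))⟫_ℂ -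
        e M M' t * ⟪Ψ.comp M, A (Ψ.comp M')⟫_ℂ‖ ≤ 2 * ‖A‖ * (T / Q.hbar * Ψ.E) := by
      intro M hM M' hM'
      have he : ‖e M M' t‖ = 1 := by
        simp only [e]
        rw [show Complex.I * (ω M M' : ℂ) * (t : ℂ) = ((ω M M' * t : ℝ) : ℂ) * Complex.I by
          push_cast; ring, Complex.norm_exp_ofReal_mul_I]
      rw [← mul_sub, norm_mul, he, one_mul]
      refine (Ψ.norm_inner_expHam_sub_le A hM hM' _).trans ?_
      rw [abs_of_nonneg (div_nonneg ht.1.le hħ.le)]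
      gcongr
      exact ht.2
    refine (norm_sum_le_of_le _ fun M hM => norm_sum_le_of_le _ (hterm M hM)).trans_eq ?_
    simp only [Finset.sum_const, nsmul_eq_mul, N]
    ring
  have hDint : ∫ t in (0 : ℝ)..T, D t = ∑ M ∈ Ψ.S, ∑ M' ∈ Ψ.S,
      (∫ t in (0 : ℝ)..T, e M M' t) * ⟪Ψ.comp M, A (Ψ.comp M')⟫_ℂ := by
    simp only [D]
    rw [intervalIntegral.integral_finsetSum fun M _ =>
      Continuous.intervalIntegrable (by fun_prop) _ _]
    refine Finset.sum_congr rfl fun M _ => ?_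
    rw [intervalIntegral.integral_finsetSum fun M' _ =>
      Continuous.intervalIntegrable (by fun_prop) _ _]
    exact Finset.sum_congr rfl fun M' _ => intervalIntegral.integral_mul_const _ _
  have hdiag : Ψ.diagonalValue A = ∑ M ∈ Ψ.S, ∑ M' ∈ Ψ.S,
      (if M = M' then 1 else 0) * ⟪Ψ.comp M, A (Ψ.comp M')⟫_ℂ := by
    refine Finset.sum_congr rfl fun M hM => ?_
    simp [hM]
  have hosc : ‖((1 / T : ℂ) * ∫ t in (0 : ℝ)..T, D t) - Ψ.diagonalValue A‖ ≤
      Ψ.lowerRatio A T := by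
    have hterm : ∀ M ∈ Ψ.S, ∀ M' ∈ Ψ.S,
        ‖(1 / T : ℂ) * ((∫ t in (0 : ℝ)..T, e M M' t) * ⟪Ψ.comp M, A (Ψ.comp M')⟫_ℂ) -
          (if M = M' then 1 else 0) * ⟪Ψ.comp M, A (Ψ.comp M')⟫_ℂ‖ ≤
        2 * Q.hbar * ‖A‖ / (Ψ.δM * Q.c ^ 2 * T) := by
      intro M hM M' hM'
      have hδ := Ψ.δM_nonneg
      -- Diagonal pairs cancel exactly, so the bound survives a single mass, where `δM = 0` and the
      -- right-hand side is `0`.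
      rcases eq_or_ne M M' with rfl | hne
      · have : ∫ t in (0 : ℝ)..T, e M M t = T := by simp [e, ω]
        rw [this, if_pos rfl, one_mul, ← mul_assoc, one_div_mul_cancel hTC, one_mul, sub_self,
          norm_zero]
        positivity
      · have hδ0 := Ψ.δM_pos hM hM' hne
        have hω : ω M M' ≠ 0 := mul_ne_zero (sub_ne_zero.2 hne) (by positivity)
        have hω2 : Ψ.δM * (Q.c ^ 2 / Q.hbar) ≤ |ω M M'| := by
          rw [abs_mul, abs_of_pos (a := Q.c ^ 2 / Q.hbar) (by positivity)]
          gcongr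
          exact Ψ.δM_le hM hM' hne
        have hinner : ‖⟪Ψ.comp M, A (Ψ.comp M')⟫_ℂ‖ ≤ 1 * (‖A‖ * 1) := by
          refine (norm_inner_le_norm _ _).trans ?_
          gcongr
          · exact Ψ.norm_comp_le_one hM
          · exact A.le_opNorm_of_le (Ψ.norm_comp_le_one hM')
        rw [if_neg hne, zero_mul, sub_zero, norm_mul, norm_mul, norm_div, norm_one,
          Complex.norm_real, Real.norm_of_nonneg hT.le]
        calc _ ≤ 1 / T * (2 / (Ψ.δM * (Q.c ^ 2 / Q.hbar)) * (1 * (‖A‖ * 1))) := by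
              gcongr
              exact (norm_intervalIntegral_exp_le hω T).trans (by gcongr)
          _ = _ := by field_simp
    rw [hDint, hdiag]
    simp only [Finset.mul_sum, ← Finset.sum_sub_distrib]
    refine (norm_sum_le_of_le _ fun M hM => norm_sum_le_of_le _ (hterm M hM)).trans_eq ?_
    simp only [Finset.sum_const, nsmul_eq_mul, lowerRatio, N]
    ring
  have hsplit : Ψ.timeAverage A T - Ψ.diagonalValue A =
      (((1 / T : ℂ) * ∫ t in (0 : ℝ)..T, D t) - Ψ.diagonalValue A) +
        (1 / T : ℂ) * ∫ t in (0 : ℝ)..T, (f t - D t) := by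
    rw [intervalIntegral.integral_sub (hfc.intervalIntegrable _ _) (hDc.intervalIntegrable _ _),
      timeAverage]
    ring
  rw [hsplit]
  refine norm_add_le_of_le hosc ?_
  rw [norm_mul, norm_div, norm_one, Complex.norm_real, Real.norm_of_nonneg hT.le]
  rw [sub_zero, abs_of_pos hT] at hfD
  calc _ ≤ 1 / T * ((Ψ.N : ℝ) ^ 2 * (2 * ‖A‖ * (T / Q.hbar * Ψ.E)) * T) := by gcongr
    _ = Ψ.upperRatio A T := by
      rw [upperRatio]
      field_simp

end Superposition

end MassSuperselection

end

theorem mainTheorem1 :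
    (∀ (H : Type*) [NormedAddCommGroup H] [InnerProductSpace ℂ H] [CompleteSpace H]
        [TopologicalSpace.SeparableSpace H] (Q : MassSuperselection.MassSystem H)
        (Ψ : MassSuperselection.Superposition Q) (A : H →L[ℂ] H),
        (∃ A_B : H →L[ℂ] H, MassSuperselection.IsBlockDiagonalPart Q.mass A A_B ∧
          MassSuperselection.HasTrace (Ψ.mixture * A_B) (Ψ.diagonalValue A)) ∧
        ∀ T : ℝ, 0 < T →
          ‖Ψ.timeAverage A T - Ψ.diagonalValue A‖ ≤ Ψ.lowerRatio A T + Ψ.upperRatio A T) ∧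
    (∀ (ι : Type*) (l : Filter ι) (H : ι → Type*) [∀ i, NormedAddCommGroup (H i)]
        [∀ i, InnerProductSpace ℂ (H i)] [∀ i, CompleteSpace (H i)]
        [∀ i, TopologicalSpace.SeparableSpace (H i)]
        (Q : ∀ i, MassSuperselection.MassSystem (H i))
        (Ψ : ∀ i, MassSuperselection.Superposition (Q i)) (A : ∀ i, H i →L[ℂ] H i)
        (T : ι → ℝ), (∀ i, 0 < T i) →
        Tendsto (fun i => (Ψ i).lowerRatio (A i) (T i)) l (𝓝 0) →
        Tendsto (fun i => (Ψ i).upperRatio (A i) (T i)) l (𝓝 0) →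
        Tendsto (fun i => (Ψ i).timeAverage (A i) (T i) - (Ψ i).diagonalValue (A i)) l (𝓝 0)) := by
  refine ⟨fun H _ _ _ _ Q Ψ A => ⟨?_, fun T hT => Ψ.norm_timeAverage_sub_le A hT⟩, ?_⟩
  · obtain ⟨B, hB⟩ :=
      MassSuperselection.exists_hasSum_starProjection_comp Q.orthogonalFamily A
    exact ⟨B, hB, Ψ.hasTrace_mixture hB⟩
  · intro ι l H _ _ _ _ Q Ψ A T hT hlower hupper
    -- The bound depends on the data only through the two ratios, so the spaces may vary with `i`.
    refine squeeze_zero_norm (fun i => (Ψ i).norm_timeAverage_sub_le (A i) (hT i)) ?_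
    simpa using hlower.add hupper
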